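/- **Grid.** Consider a hybrid AC/DC grid with buses $\mathcal V=\{1,\dots,N_V\}$, AC branches $\mathcal E=\{1,\dots,N_E\}$ and DC branches $\mathcal D=\{1,\dots,N_D\}$, of arbitrary topology (e.g. with an AC part that is a tree), but without AC self-loops and without parallel or antiparallel AC branches. AC branch $k$ goes from bus $\hat\epsilon(k)$ to bus $\check\epsilon(k)$, DC branch $l$ from $\hat\delta(l)$ to $\check\delta(l)$. AC branch $k$ has a series admittance $\bar y_k$, shunt admittances $\hat y_k,\check y_k$, and ideal transformers with complex ratios $\hat\rho_k,\check\rho_k\neq0$ at its source and destination, so that with bus voltages $v\in\mathbb C^{N_V}$, $i=\hat\epsilon(k)$, $j=\check\epsilon(k)$ its source and destination currents are $$\hat I_k=|\hat\rho_k|^2(\bar y_k+\hat y_k)v_i-\hat\rho_k^*\check\rho_k\bar y_k v_j,\qquad \check I_k=|\check\rho_k|^2(\bar y_k+\check y_k)v_j-\check\rho_k^*\hat\rho_k\bar y_k v_i .$$ Let $\rho_k=\hat\rho_k^*\check\rho_k$. Bus $n$ has a shunt admittance $\tilde y_n\in\mathbb C$, $Y$ is the bus admittance matrix, i.e. $(Yv)_n=\tilde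 y_nv_n+\sum_{k:\hat\epsilon(k)=n}\hat I_k+\sum_{k:\check\epsilon(k)=n}\check I_k$, and $M_n=e_ne_n^{T}$, $$P_n=\tfrac12(Y^HM_n+M_nY),\qquad Q_n=\tfrac1{2\mathrm i}(Y^HM_n-M_nY).$$ DC branch $l$ has a loss factor $\eta_l\in[0,1)$, and $h_n\in\mathbb R^{N_D}$ is given by $[h_n]_l=\mathbf 1[\hat\delta(l)=n]-(1-\eta_l)\mathbf 1[\check\delta(l)=n]$. The $M=2N_V+7N_E+2N_D$ inequality constraints of the optimal power flow problem are, for all $n\in\mathcal V$, $k\in\mathcal E$, $l\in\mathcal D$, with $i=\hat\epsilon(k)$, $j=\check\epsilon(k)$, $w_k=v_i^*v_j$ and DC flows $p\in\mathbb R^{N_D}$, $$\underline V_n^2\le|v_n|^2\le\overline V_n^2,\quad |\hat I_k|^2\le\hat{\bar I}_k^2,\quad |\check I_k|^2\le\check{\bar I}_k^2,\quad (1+\underline\nu_k)^2|v_i|^2\le|v_j|^2\le(1+\overline\nu_k)^2|v_i|^2,$$ $$\operatorname{Re}w_k\ge0,\quad \tan(\underline\delta_k)\operatorname{Re}w_k\le\operatorname{Im}w_k\le\tan(\overline\delta_k)\operatorname{Re}w_k,\quad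 \underline p_l\le p_l\le\overline p_l ,$$ written as $v^HC_mv+c_m^Tp\le b_m$ with Hermitian $C_m$, $m=1,\dots,M$. The model assumes, for all buses and branches: $0<\underline V_n\le\overline V_n$; $\hat{\bar I}_k,\check{\bar I}_k\ge0$; $-1\le\underline\nu_k\le\overline\nu_k$; $\underline p_l\le\overline p_l$; $\operatorname{Re}\bar y_k>0$ (lossy) and $\operatorname{Im}\bar y_k\le0$ (inductive); $\operatorname{Re}(\hat y_k/\bar y_k)\ge-1$ and $\operatorname{Re}(\check y_k/\bar y_k)\ge-1$ (e.g. if $|\hat y_k|,|\check y_k|\le|\bar y_k|$); and $-\pi/2<\underline\delta_k\le-\arg\rho_k\le\overline\delta_k<\pi/2$. **Market.** At bus $n$, the generation $g_n$ and the load $d_n$ lie in nonempty, compact, convex sets $\mathcal G_n,\mathcal D_n\subset\mathbb R^2$ (active and reactive power), with convex cost $C_n:\mathcal G_n\to\mathbb R$ and concave benefit $B_n:\mathcal D_n\to\mathbb R$. For $\lambda\in\mathbb R^2$ let $$\sigma^B_n(\lambda)=\sup_{d\in\mathcal D_n}\{B_n(d)-\lambda^Td\},\qquad \sigma^C_n(\lambda)=\sup_{g\in\mathcal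 G_n}\{\lambda^Tg-C_n(g)\}.$$ **Dual problem.** For $\Lambda=(\Lambda_n)_{n\in\mathcal V}$ with $\Lambda_n\in\mathbb R^2$ and $\mu\in\mathbb R^M$ let $$\Psi(\Lambda,\mu)=\sum_{n}\big([\Lambda_n]_1P_n+[\Lambda_n]_2Q_n\big)+\sum_m\mu_mC_m,\qquad \psi(\Lambda,\mu)=\sum_n[\Lambda_n]_1h_n+\sum_m\mu_mc_m .$$ With $S_k=[e_{\hat\epsilon(k)},e_{\check\epsilon(k)}]\in\{0,1\}^{N_V\times2}$, the dual of the second-order cone (SOC) relaxation of the optimal power flow problem is to minimize $$\mu^Tb+\sum_n\sigma^B_n(\Lambda_n)+\sum_n\sigma^C_n(\Lambda_n)$$ over $\Lambda_n\in\mathbb R^2$ ($n\in\mathcal V$), $\mu\in\mathbb R^M_{\ge0}$ and Hermitian $L_k\in\mathbb C^{2\times2}$ ($k\in\mathcal E$), subject to $$\Psi(\Lambda,\mu)=\sum_{k\in\mathcal E}S_kL_kS_k^T,\qquad\psi(\Lambda,\mu)=0,\qquad L_k\succeq0\ \ (k\in\mathcal E).$$ For $k\in\mathcal E$ let $\mathcal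 A_k=\{(\Lambda,\mu):[\Psi(\Lambda,\mu)]_{\hat\epsilon(k),\check\epsilon(k)}=0\}$. **Theorem.** Let $(\Lambda^\star,\mu^\star,L^\star)$ be an optimizer of this dual problem, let $k\in\mathcal E$, $i=\hat\epsilon(k)$ and $j=\check\epsilon(k)$. If $\Lambda_i^\star\ge0$ and $\Lambda_j^\star\ge0$ (componentwise) and $[\Lambda_i^\star]_1+[\Lambda_j^\star]_1>0$, then $(\Lambda^\star,\mu^\star)\notin\mathcal A_k$; equivalently, $[\Psi(\Lambda^\star,\mu^\star)]_{i,j}\ne0$. -/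

import Mathlib

open scoped Matrix ComplexOrder BigOperators

noncomputable section

/-- Data of a hybrid AC/DC transmission grid with `nV` buses, `nE` AC branches and `nD` DC
branches. An AC branch consists of an ideal transformer (complex ratio) at either end and a
Pi-equivalent circuit (one series and two shunt admittances) between them. -/
structure HybridGrid (nV nE nD : ℕ) where
  /-- source and destination bus of the AC branches -/
  src : Fin nE → Fin nV
  dst : Fin nE → Fin nV
  /-- source and destination bus of the DC branches -/
  dcSrc : Fin nD → Fin nV
  dcDst : Fin nD → Fin nV
  /-- shunt admittance at the buses -/
  yBus : Fin nV → ℂ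
  /-- series admittance of the AC branches -/
  ySer : Fin nE → ℂ
  /-- shunt admittances of the AC branches at the source and at the destination -/
  ySrc : Fin nE → ℂ
  yDst : Fin nE → ℂ
  /-- complex transformer ratios of the AC branches at the source and at the destination -/
  rSrc : Fin nE → ℂ
  rDst : Fin nE → ℂ
  /-- loss factor of the DC branches -/
  loss : Fin nD → ℝ
  /-- bounds on the bus voltage magnitudes -/
  vLB : Fin nV → ℝ
  vUB : Fin nV → ℝ
  /-- upper bounds on the current magnitude at the source and at the destination -/
  iSrcUB : Fin nE → ℝ
  iDstUB : Fin nE → ℝ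
  /-- bounds on the relative voltage magnitude drop `|v_dst| / |v_src| - 1` -/
  dropLB : Fin nE → ℝ
  dropUB : Fin nE → ℝ
  /-- bounds on the voltage angle difference `arg (conj v_src * v_dst)` -/
  angLB : Fin nE → ℝ
  angUB : Fin nE → ℝ
  /-- bounds on the DC branch flows -/
  pLB : Fin nD → ℝ
  pUB : Fin nD → ℝ

/-- The inequality constraints of the optimal power flow problem: two for every bus, seven for
every AC branch and two for every DC branch, i.e., `2 nV + 7 nE + 2 nD` in total. -/
abbrev OPFConstraint (nV nE nD : ℕ) : Type :=
  (Fin 2 × Fin nV) ⊕ (Fin 7 × Fin nE) ⊕ (Fin 2 × Fin nD)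

namespace HybridGrid

variable {nV nE nD : ℕ}

/-- Total voltage ratio of an AC branch. -/
def ratio (G : HybridGrid nV nE nD) (k : Fin nE) : ℂ :=
  (starRingEnd ℂ) (G.rSrc k) * G.rDst k

/-- The assumptions of the grid model. The topology (tree or meshed) is unrestricted, but there
are no AC self-loops and no parallel or antiparallel AC branches. -/
structure IsModel (G : HybridGrid nV nE nD) : Prop where
  no_loop : ∀ k, G.src k ≠ G.dst k
  no_parallel : ∀ k l, s(G.src k, G.dst k) = s(G.src l, G.dst l) → k = l
  rSrc_ne : ∀ k, G.rSrc k ≠ 0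
  rDst_ne : ∀ k, G.rDst k ≠ 0
  /-- the AC branches are lossy -/
  lossy : ∀ k, 0 < (G.ySer k).re
  /-- the AC branches are not capacitive -/
  inductive_series : ∀ k, (G.ySer k).im ≤ 0
  /-- the shunt admittances are small in relation to the series admittance: this holds, e.g.,
  if their absolute value does not exceed that of the series admittance -/
  shunt_src : ∀ k, -1 ≤ (G.ySrc k / G.ySer k).re
  shunt_dst : ∀ k, -1 ≤ (G.yDst k / G.ySer k).re
  loss_mem : ∀ l, G.loss l ∈ Set.Ico (0 : ℝ) 1
  vLB_pos : ∀ n, 0 < G.vLB n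
  vLB_le : ∀ n, G.vLB n ≤ G.vUB n
  iSrcUB_nonneg : ∀ k, 0 ≤ G.iSrcUB k
  iDstUB_nonneg : ∀ k, 0 ≤ G.iDstUB k
  dropLB_ge : ∀ k, -1 ≤ G.dropLB k
  dropLB_le : ∀ k, G.dropLB k ≤ G.dropUB k
  angLB_gt : ∀ k, -(Real.pi / 2) < G.angLB k
  angUB_lt : ∀ k, G.angUB k < Real.pi / 2
  /-- the angle range admits a zero angle difference across the Pi-equivalent circuit
  (behind the transformers) -/
  angLB_le : ∀ k, G.angLB k ≤ -(G.ratio k).arg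
  le_angUB : ∀ k, -(G.ratio k).arg ≤ G.angUB k
  pLB_le : ∀ l, G.pLB l ≤ G.pUB l

/-- The row vector that maps the bus voltages to the current that flows into AC branch `k` at its
source bus. -/
def srcCurrent (G : HybridGrid nV nE nD) (k : Fin nE) : Fin nV → ℂ :=
  Pi.single (G.src k) ((starRingEnd ℂ) (G.rSrc k) * G.rSrc k * (G.ySer k + G.ySrc k))
    - Pi.single (G.dst k) ((starRingEnd ℂ) (G.rSrc k) * G.rDst k * G.ySer k)

/-- The row vector that maps the bus voltages to the current that flows into AC branch `k` at its
destination bus. -/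
def dstCurrent (G : HybridGrid nV nE nD) (k : Fin nE) : Fin nV → ℂ :=
  Pi.single (G.dst k) ((starRingEnd ℂ) (G.rDst k) * G.rDst k * (G.ySer k + G.yDst k))
    - Pi.single (G.src k) ((starRingEnd ℂ) (G.rDst k) * G.rSrc k * G.ySer k)

/-- Bus admittance matrix: row `n` maps the bus voltages to the current injected at bus `n`. -/
def admittance (G : HybridGrid nV nE nD) : Matrix (Fin nV) (Fin nV) ℂ :=
  Matrix.of fun n =>
    Pi.single n (G.yBus n)
      + ∑ k, ((if G.src k = n then G.srcCurrent k else 0)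
        + (if G.dst k = n then G.dstCurrent k else 0))

/-- `e_n e_nᵀ` -/
def matM (n : Fin nV) : Matrix (Fin nV) (Fin nV) ℂ := Matrix.single n n 1

/-- `vᴴ P_n v` is the active power injected into the AC branches and the shunt at bus `n`. -/
def matP (G : HybridGrid nV nE nD) (n : Fin nV) : Matrix (Fin nV) (Fin nV) ℂ :=
  (1 / 2 : ℂ) • (G.admittanceᴴ * matM n + matM n * G.admittance)

/-- `vᴴ Q_n v` is the reactive power injected into the AC branches and the shunt at bus `n`. -/
def matQ (G : HybridGrid nV nE nD) (n : Fin nV) : Matrix (Fin nV) (Fin nV) ℂ :=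
  (1 / (2 * Complex.I) : ℂ) • (G.admittanceᴴ * matM n - matM n * G.admittance)

/-- `vᴴ I v` is the squared magnitude of the source current of AC branch `k`. -/
def matISrc (G : HybridGrid nV nE nD) (k : Fin nE) : Matrix (Fin nV) (Fin nV) ℂ :=
  Matrix.vecMulVec (star (G.srcCurrent k)) (G.srcCurrent k)

/-- `vᴴ I v` is the squared magnitude of the destination current of AC branch `k`. -/
def matIDst (G : HybridGrid nV nE nD) (k : Fin nE) : Matrix (Fin nV) (Fin nV) ℂ :=
  Matrix.vecMulVec (star (G.dstCurrent k)) (G.dstCurrent k)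

/-- `(1 + dropLB)² |v_src|² - |v_dst|²` -/
def matDropLB (G : HybridGrid nV nE nD) (k : Fin nE) : Matrix (Fin nV) (Fin nV) ℂ :=
  ((1 + G.dropLB k) ^ 2) • matM (G.src k) - matM (G.dst k)

/-- `|v_dst|² - (1 + dropUB)² |v_src|²` -/
def matDropUB (G : HybridGrid nV nE nD) (k : Fin nE) : Matrix (Fin nV) (Fin nV) ℂ :=
  matM (G.dst k) - ((1 + G.dropUB k) ^ 2) • matM (G.src k)

/-- The quadratic form of this matrix is `Re (conj v_src * v_dst)`. -/
def matRe (G : HybridGrid nV nE nD) (k : Fin nE) : Matrix (Fin nV) (Fin nV) ℂ :=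
  (1 / 2 : ℂ) •
    (Matrix.single (G.src k) (G.dst k) 1 + Matrix.single (G.dst k) (G.src k) 1)

/-- The quadratic form of this matrix is `Im (conj v_src * v_dst)`. -/
def matIm (G : HybridGrid nV nE nD) (k : Fin nE) : Matrix (Fin nV) (Fin nV) ℂ :=
  (1 / (2 * Complex.I) : ℂ) •
    (Matrix.single (G.src k) (G.dst k) 1 - Matrix.single (G.dst k) (G.src k) 1)

/-- The angle difference lies in `[angLB, angUB] ⊂ (-π/2, π/2)`, expressed by
`-Re w ≤ 0`, `tan angLB * Re w - Im w ≤ 0`, `Im w - tan angUB * Re w ≤ 0`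
with `w = conj v_src * v_dst`. -/
def matAng (G : HybridGrid nV nE nD) (k : Fin nE) : Matrix (Fin nV) (Fin nV) ℂ :=
  -G.matRe k

def matAngLB (G : HybridGrid nV nE nD) (k : Fin nE) : Matrix (Fin nV) (Fin nV) ℂ :=
  Real.tan (G.angLB k) • G.matRe k - G.matIm k

def matAngUB (G : HybridGrid nV nE nD) (k : Fin nE) : Matrix (Fin nV) (Fin nV) ℂ :=
  G.matIm k - Real.tan (G.angUB k) • G.matRe k

/-- `h_nᵀ p` is the active power injected into the DC branches at bus `n`. -/
def vecH (G : HybridGrid nV nE nD) (n : Fin nV) : Fin nD → ℝ := fun l =>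
  (if G.dcSrc l = n then 1 else 0) - (if G.dcDst l = n then 1 - G.loss l else 0)

/-- The inequality constraints of the optimal power flow problem read
`vᴴ C_m v + c_mᵀ p ≤ b_m`. -/
def matC (G : HybridGrid nV nE nD) : OPFConstraint nV nE nD → Matrix (Fin nV) (Fin nV) ℂ
  | .inl (a, n) => ![-matM n, matM n] a
  | .inr (.inl (a, k)) =>
      ![G.matISrc k, G.matIDst k, G.matDropLB k, G.matDropUB k,
        G.matAng k, G.matAngLB k, G.matAngUB k] a
  | .inr (.inr _) => 0

def vecC (_ : HybridGrid nV nE nD) : OPFConstraint nV nE nD → Fin nD → ℝ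
  | .inl _ => 0
  | .inr (.inl _) => 0
  | .inr (.inr (a, l)) => ![-Pi.single l 1, Pi.single l 1] a

def bound (G : HybridGrid nV nE nD) : OPFConstraint nV nE nD → ℝ
  | .inl (a, n) => ![-(G.vLB n) ^ 2, (G.vUB n) ^ 2] a
  | .inr (.inl (a, k)) => ![(G.iSrcUB k) ^ 2, (G.iDstUB k) ^ 2, 0, 0, 0, 0, 0] a
  | .inr (.inr (a, l)) => ![-G.pLB l, G.pUB l] a

/-- `Ψ(Λ, μ)`, where `Λ n 0` and `Λ n 1` are the dual variables of the active and of the reactive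
power balance at bus `n`. -/
def Psi (G : HybridGrid nV nE nD) (Λ : Fin nV → Fin 2 → ℝ) (μ : OPFConstraint nV nE nD → ℝ) :
    Matrix (Fin nV) (Fin nV) ℂ :=
  ∑ n, (Λ n 0 • G.matP n + Λ n 1 • G.matQ n) + ∑ m, μ m • G.matC m

/-- `ψ(Λ, μ)` -/
def psi (G : HybridGrid nV nE nD) (Λ : Fin nV → Fin 2 → ℝ) (μ : OPFConstraint nV nE nD → ℝ) :
    Fin nD → ℝ :=
  ∑ n, Λ n 0 • G.vecH n + ∑ m, μ m • G.vecC m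

/-- `S_k = [e_src, e_dst]` -/
def matS (G : HybridGrid nV nE nD) (k : Fin nE) : Matrix (Fin nV) (Fin 2) ℂ :=
  Matrix.of fun n c => if n = ![G.src k, G.dst k] c then 1 else 0

/-- The set `A_k` of dual variables for which the off-diagonal entry of `Ψ` that belongs to AC
branch `k` vanishes. -/
def setA (G : HybridGrid nV nE nD) (k : Fin nE) :
    Set ((Fin nV → Fin 2 → ℝ) × (OPFConstraint nV nE nD → ℝ)) :=
  {x | G.Psi x.1 x.2 (G.src k) (G.dst k) = 0}

end HybridGrid

/-- Generation and load at the buses: capability regions in the P-Q plane, producer cost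
functions and consumer benefit functions (relevant on the regions only). -/
structure PowerMarket (nV : ℕ) where
  gen : Fin nV → Set (Fin 2 → ℝ)
  load : Fin nV → Set (Fin 2 → ℝ)
  cost : Fin nV → (Fin 2 → ℝ) → ℝ
  benefit : Fin nV → (Fin 2 → ℝ) → ℝ

namespace PowerMarket

variable {nV : ℕ}

structure IsModel (K : PowerMarket nV) : Prop where
  gen_nonempty : ∀ n, (K.gen n).Nonempty
  gen_compact : ∀ n, IsCompact (K.gen n)
  load_nonempty : ∀ n, (K.load n).Nonempty
  load_compact : ∀ n, IsCompact (K.load n)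
  /-- the generation regions and the cost functions are convex -/
  cost_convex : ∀ n, ConvexOn ℝ (K.gen n) (K.cost n)
  /-- the load regions are convex and the benefit functions are concave -/
  benefit_concave : ∀ n, ConcaveOn ℝ (K.load n) (K.benefit n)

/-- Consumer's surplus at bus `n` for the prices `x`. The supremum is finite, as a concave function
on a nonempty, compact, convex subset of the plane is bounded above. -/
def surplus (K : PowerMarket nV) (n : Fin nV) (x : Fin 2 → ℝ) : ℝ :=
  sSup ((fun d => K.benefit n d - x ⬝ᵥ d) '' K.load n)

/-- Producer's profit at bus `n` for the prices `x`. -/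
def profit (K : PowerMarket nV) (n : Fin nV) (x : Fin 2 → ℝ) : ℝ :=
  sSup ((fun g => x ⬝ᵥ g - K.cost n g) '' K.gen n)

end PowerMarket

namespace HybridGrid

variable {nV nE nD : ℕ}

/-- Objective of the dual of the second-order cone relaxation. -/
def dualObjective (G : HybridGrid nV nE nD) (K : PowerMarket nV)
    (Λ : Fin nV → Fin 2 → ℝ) (μ : OPFConstraint nV nE nD → ℝ) : ℝ :=
  μ ⬝ᵥ G.bound + ∑ n, K.surplus n (Λ n) + ∑ n, K.profit n (Λ n)

/-- Feasibility in the dual of the second-order cone relaxation. -/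
structure IsDualFeasible (G : HybridGrid nV nE nD)
    (Λ : Fin nV → Fin 2 → ℝ) (μ : OPFConstraint nV nE nD → ℝ)
    (L : Fin nE → Matrix (Fin 2) (Fin 2) ℂ) : Prop where
  mu_nonneg : 0 ≤ μ
  psi_mat : G.Psi Λ μ = ∑ k, G.matS k * L k * (G.matS k)ᵀ
  psi_vec : G.psi Λ μ = 0
  posSemidef : ∀ k, (L k).PosSemidef

/-- `(Λ, μ, L)` is an optimizer of the dual of the second-order cone relaxation. -/
def IsDualOptimizer (G : HybridGrid nV nE nD) (K : PowerMarket nV)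
    (Λ : Fin nV → Fin 2 → ℝ) (μ : OPFConstraint nV nE nD → ℝ)
    (L : Fin nE → Matrix (Fin 2) (Fin 2) ℂ) : Prop :=
  G.IsDualFeasible Λ μ L ∧
    ∀ Λ' μ' L', G.IsDualFeasible Λ' μ' L' →
      G.dualObjective K Λ μ ≤ G.dualObjective K Λ' μ'

end HybridGrid

end

/-! Write `ρ` for the total ratio of branch `k`, `i` and `j` for its ends. Every term of `Ψ` is
shown to have its `(i, j)` entry in the closed half-plane `Re (-conj ρ * w) ≥ 0`, and the power
terms together lie in its interior; so the sum cannot vanish. The half-plane has a physical meaning: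
for a Hermitian `C`, the off-diagonal pair contributes `2 Re (C i j * w)` to the form, with `w =
conj v_i * v_j`. The choice `w = conj ρ` is a zero angle across the Pi-circuit, so the claim is that
no constraint has a positive off-diagonal contribution there. The power terms are strict because of
losses and nonnegative prices (`re_sum_matP_matQ_pos`); the constraint terms are covered by
`re_matC_nonneg` and enter with weights `μ ≥ 0`. -/

namespace HybridGrid

variable {nV nE nD : ℕ} {G : HybridGrid nV nE nD}

/-! ### Topology and the coefficients of the branch currents -/

/-- Distinct AC branches do not have the same source and destination bus. -/
lemma IsModel.not_parallel (hG : G.IsModel) {k l : Fin nE} (h : l ≠ k) :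
    ¬(G.src l = G.src k ∧ G.dst l = G.dst k) := fun ⟨h₁, h₂⟩ =>
  h (hG.no_parallel l k (by rw [h₁, h₂]))

/-- Distinct AC branches do not connect the same buses in opposite directions. -/
lemma IsModel.not_antiparallel (hG : G.IsModel) {k l : Fin nE} (h : l ≠ k) :
    ¬(G.src l = G.dst k ∧ G.dst l = G.src k) := fun ⟨h₁, h₂⟩ =>
  h (hG.no_parallel l k (by rw [h₁, h₂, Sym2.eq_swap]))

lemma IsModel.ratio_ne (hG : G.IsModel) (k : Fin nE) : G.ratio k ≠ 0 :=
  mul_ne_zero (by simpa using hG.rSrc_ne k) (hG.rDst_ne k)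

lemma IsModel.srcCurrent_src (hG : G.IsModel) (k : Fin nE) :
    G.srcCurrent k (G.src k)
      = (starRingEnd ℂ) (G.rSrc k) * G.rSrc k * (G.ySer k + G.ySrc k) := by
  simp [srcCurrent, hG.no_loop k]

lemma IsModel.srcCurrent_dst (hG : G.IsModel) (k : Fin nE) :
    G.srcCurrent k (G.dst k) = -(G.ratio k * G.ySer k) := by
  simp [srcCurrent, ratio, (hG.no_loop k).symm]

lemma IsModel.dstCurrent_dst (hG : G.IsModel) (k : Fin nE) :
    G.dstCurrent k (G.dst k)
      = (starRingEnd ℂ) (G.rDst k) * G.rDst k * (G.ySer k + G.yDst k) := by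
  simp [dstCurrent, (hG.no_loop k).symm]

lemma IsModel.dstCurrent_src (hG : G.IsModel) (k : Fin nE) :
    G.dstCurrent k (G.src k) = -((starRingEnd ℂ) (G.ratio k) * G.ySer k) := by
  simp [dstCurrent, ratio, hG.no_loop k, mul_comm]

lemma srcCurrent_eq_zero {l : Fin nE} {n : Fin nV} (h₁ : n ≠ G.src l) (h₂ : n ≠ G.dst l) :
    G.srcCurrent l n = 0 := by
  simp [srcCurrent, h₁, h₂]

lemma dstCurrent_eq_zero {l : Fin nE} {n : Fin nV} (h₁ : n ≠ G.src l) (h₂ : n ≠ G.dst l) :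
    G.dstCurrent l n = 0 := by
  simp [dstCurrent, h₁, h₂]

/-- A branch other than `k` is not incident to both ends of `k`. -/
lemma IsModel.not_incident (hG : G.IsModel) {k l : Fin nE} (h : l ≠ k) :
    (G.src k ≠ G.src l ∧ G.src k ≠ G.dst l) ∨ (G.dst k ≠ G.src l ∧ G.dst k ≠ G.dst l) := by
  have h₁ := hG.not_parallel h
  have h₂ := hG.not_antiparallel h
  have h₃ := hG.no_loop k
  grind

/-- The bus shunt is diagonal, and any other branch misses an end of `k`: either it is not selected
in this row, or its current has coefficient zero in this column. Only branch `k` remains. -/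
lemma IsModel.admittance_src_dst (hG : G.IsModel) (k : Fin nE) :
    G.admittance (G.src k) (G.dst k) = -(G.ratio k * G.ySer k) := by
  have h := hG.no_loop k
  simp only [admittance, Matrix.of_apply, Pi.add_apply, Finset.sum_apply]
  rw [Pi.single_eq_of_ne h.symm, zero_add, Finset.sum_eq_single k]
  · simp [h.symm, hG.srcCurrent_dst]
  · intro l _ hl
    rcases hG.not_incident hl with h' | h'
    · simp [h'.1.symm, h'.2.symm]
    · split_ifs <;> simp [srcCurrent_eq_zero h'.1 h'.2, dstCurrent_eq_zero h'.1 h'.2]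
  · simp

lemma IsModel.admittance_dst_src (hG : G.IsModel) (k : Fin nE) :
    G.admittance (G.dst k) (G.src k) = -((starRingEnd ℂ) (G.ratio k) * G.ySer k) := by
  have h := hG.no_loop k
  simp only [admittance, Matrix.of_apply, Pi.add_apply, Finset.sum_apply]
  rw [Pi.single_eq_of_ne h, zero_add, Finset.sum_eq_single k]
  · simp [h, hG.dstCurrent_src]
  · intro l _ hl
    rcases hG.not_incident hl with h' | h'
    · split_ifs <;> simp [srcCurrent_eq_zero h'.1 h'.2, dstCurrent_eq_zero h'.1 h'.2]
    · simp [h'.1.symm, h'.2.symm]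
  · simp

/-! ### Power matrices: the strictly positive part -/

lemma conjTranspose_mul_matM_apply (A : Matrix (Fin nV) (Fin nV) ℂ) (n i j : Fin nV) :
    (Aᴴ * matM n) i j = if n = j then star (A j i) else 0 := by
  split_ifs with h
  · subst h; simp [matM]
  · simp [matM, Ne.symm h]

lemma matM_mul_apply (A : Matrix (Fin nV) (Fin nV) ℂ) (n i j : Fin nV) :
    (matM n * A) i j = if n = i then A i j else 0 := by
  split_ifs with h
  · subst h; simp [matM]
  · simp [matM, Ne.symm h]

/-- The entry of the weighted sum of the power matrices that belongs to an AC branch. -/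
lemma IsModel.sum_matP_matQ_src_dst (hG : G.IsModel) (Λ : Fin nV → Fin 2 → ℝ) (k : Fin nE) :
    (∑ n, (Λ n 0 • G.matP n + Λ n 1 • G.matQ n)) (G.src k) (G.dst k)
      = -(G.ratio k / 2) *
        ((Λ (G.src k) 0 + Complex.I * Λ (G.src k) 1) * G.ySer k
          + (Λ (G.dst k) 0 - Complex.I * Λ (G.dst k) 1) * (starRingEnd ℂ) (G.ySer k)) := by
  -- `M_n Y` lives in row `n` and `Yᴴ M_n` in column `n`, so only the two ends of `k` contribute.
  -- Conjugating the opposite admittance entry turns `conj ρ` into `ρ`, which makes `ρ` a common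
  -- factor.
  have h (n : Fin nV) : (Λ n 0 • G.matP n + Λ n 1 • G.matQ n) (G.src k) (G.dst k)
      = (if n = G.src k then -(G.ratio k / 2) * ((Λ n 0 + Complex.I * Λ n 1) * G.ySer k) else 0)
        + (if n = G.dst k then
            -(G.ratio k / 2) * ((Λ n 0 - Complex.I * Λ n 1) * (starRingEnd ℂ) (G.ySer k))
          else 0) := by
    simp only [matP, matQ, Matrix.add_apply, Matrix.sub_apply, Matrix.smul_apply,
      conjTranspose_mul_matM_apply, matM_mul_apply, hG.admittance_src_dst, hG.admittance_dst_src,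
      Complex.real_smul, smul_eq_mul]
    have hI : (1 / (2 * Complex.I) : ℂ) = -Complex.I / 2 := by
      field_simp; simp
    rw [hI]
    split_ifs <;> simp <;> ring
  rw [Matrix.sum_apply, Finset.sum_congr rfl fun n _ => h n, Finset.sum_add_distrib]
  simp
  ring

/-- Multiplied by minus the conjugate of the total voltage ratio, the entry of the weighted sum of
the power matrices that belongs to an AC branch has a positive real part. -/
lemma IsModel.re_sum_matP_matQ_pos (hG : G.IsModel) {Λ : Fin nV → Fin 2 → ℝ} {k : Fin nE}
    (hi : 0 ≤ Λ (G.src k)) (hj : 0 ≤ Λ (G.dst k))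
    (hpos : 0 < Λ (G.src k) 0 + Λ (G.dst k) 0) :
    0 < (-(starRingEnd ℂ) (G.ratio k) *
      (∑ n, (Λ n 0 • G.matP n + Λ n 1 • G.matQ n)) (G.src k) (G.dst k)).re := by
  rw [hG.sum_matP_matQ_src_dst]
  set z := (Λ (G.src k) 0 + Complex.I * Λ (G.src k) 1) * G.ySer k
    + (Λ (G.dst k) 0 - Complex.I * Λ (G.dst k) 1) * (starRingEnd ℂ) (G.ySer k) with hz
  -- The conjugation of the second summand makes the signs agree: active prices pair with the
  -- conductance, which gives strictness, and reactive prices with the negated susceptance.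
  have hzre : 0 < z.re := by
    have h₁ : 0 ≤ (Λ (G.src k) 1 + Λ (G.dst k) 1) * -(G.ySer k).im :=
      mul_nonneg (add_nonneg (hi 1) (hj 1)) (neg_nonneg.2 (hG.inductive_series k))
    have h₂ := mul_pos hpos (hG.lossy k)
    have h₃ : z.re = (Λ (G.src k) 0 + Λ (G.dst k) 0) * (G.ySer k).re
        + (Λ (G.src k) 1 + Λ (G.dst k) 1) * -(G.ySer k).im := by
      simp [hz]; ring
    linarith
  have h : -(starRingEnd ℂ) (G.ratio k) * (-(G.ratio k / 2) * z)
      = ((Complex.normSq (G.ratio k) / 2 : ℝ) : ℂ) * z := by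
    push_cast
    rw [Complex.normSq_eq_conj_mul_self]; ring
  rw [h, Complex.re_ofReal_mul]
  exact mul_pos (half_pos (Complex.normSq_pos.2 (hG.ratio_ne k))) hzre

/-! ### Current limits -/

/-- The product equals `|y|² (1 + s / y)`; this is where the bound on the shunt admittances enters.
-/
lemma re_conj_mul_add_nonneg {y s : ℂ} (h : -1 ≤ (s / y).re) :
    0 ≤ ((starRingEnd ℂ) y * (y + s)).re := by
  rcases eq_or_ne y 0 with rfl | hy
  · simp
  have h' : (starRingEnd ℂ) y * (y + s) = (Complex.normSq y : ℂ) * (1 + s / y) := by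
    rw [Complex.normSq_eq_conj_mul_self]; field_simp
  rw [h', Complex.re_ofReal_mul]
  exact mul_nonneg (Complex.normSq_nonneg y) (by simp; linarith)

/-- The matrix has rank one, so its entry is a product of two current coefficients. For `l = k` the
phases of the transformers cancel against `conj ρ`, leaving a nonnegative multiple of the conjugate
of `conj y * (y + s)`; for `l ≠ k` one factor is zero. -/
lemma IsModel.re_matISrc_nonneg (hG : G.IsModel) (k l : Fin nE) :
    0 ≤ (-(starRingEnd ℂ) (G.ratio k) * G.matISrc l (G.src k) (G.dst k)).re := by
  rcases eq_or_ne l k with rfl | hl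
  · have h : -(starRingEnd ℂ) (G.ratio l) * G.matISrc l (G.src l) (G.dst l)
        = ((Complex.normSq (G.ratio l) * Complex.normSq (G.rSrc l) : ℝ) : ℂ)
          * (starRingEnd ℂ) ((starRingEnd ℂ) (G.ySer l) * (G.ySer l + G.ySrc l)) := by
      simp only [matISrc, Matrix.vecMulVec_apply, Pi.star_apply, hG.srcCurrent_src,
        hG.srcCurrent_dst, Complex.ofReal_mul, Complex.normSq_eq_conj_mul_self, map_mul,
        map_add, star_mul', star_add, Complex.star_def, Complex.conj_conj]
      ring
    rw [h, Complex.re_ofReal_mul, Complex.conj_re]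
    exact mul_nonneg (mul_nonneg (Complex.normSq_nonneg _) (Complex.normSq_nonneg _))
      (re_conj_mul_add_nonneg (hG.shunt_src l))
  · rcases hG.not_incident hl with h | h <;>
      simp [matISrc, Matrix.vecMulVec_apply, srcCurrent_eq_zero h.1 h.2]

lemma IsModel.re_matIDst_nonneg (hG : G.IsModel) (k l : Fin nE) :
    0 ≤ (-(starRingEnd ℂ) (G.ratio k) * G.matIDst l (G.src k) (G.dst k)).re := by
  rcases eq_or_ne l k with rfl | hl
  · have h : -(starRingEnd ℂ) (G.ratio l) * G.matIDst l (G.src l) (G.dst l)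
        = ((Complex.normSq (G.ratio l) * Complex.normSq (G.rDst l) : ℝ) : ℂ)
          * ((starRingEnd ℂ) (G.ySer l) * (G.ySer l + G.yDst l)) := by
      simp only [matIDst, Matrix.vecMulVec_apply, Pi.star_apply, hG.dstCurrent_src,
        hG.dstCurrent_dst, Complex.ofReal_mul, Complex.normSq_eq_conj_mul_self,
        star_mul', star_neg, Complex.star_def, Complex.conj_conj]
      ring
    rw [h, Complex.re_ofReal_mul]
    exact mul_nonneg (mul_nonneg (Complex.normSq_nonneg _) (Complex.normSq_nonneg _))
      (re_conj_mul_add_nonneg (hG.shunt_dst l))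
  · rcases hG.not_incident hl with h | h <;>
      simp [matIDst, Matrix.vecMulVec_apply, dstCurrent_eq_zero h.1 h.2]

/-! ### Voltage and angle limits -/

lemma matM_apply_of_ne {i j : Fin nV} (h : i ≠ j) (n : Fin nV) : matM n i j = 0 := by
  simp only [matM, Matrix.single_apply]
  grind

lemma IsModel.matRe_src_dst (hG : G.IsModel) (k : Fin nE) :
    G.matRe k (G.src k) (G.dst k) = 1 / 2 := by
  simp [matRe, hG.no_loop k]

lemma IsModel.matIm_src_dst (hG : G.IsModel) (k : Fin nE) :
    G.matIm k (G.src k) (G.dst k) = -Complex.I / 2 := by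
  simp [matIm, hG.no_loop k]
  ring

lemma IsModel.matRe_of_ne (hG : G.IsModel) {k l : Fin nE} (h : l ≠ k) :
    G.matRe l (G.src k) (G.dst k) = 0 := by
  have h₁ := hG.not_parallel h
  have h₂ := hG.not_antiparallel h
  simp [matRe, h₁, mt And.symm h₂]

lemma IsModel.matIm_of_ne (hG : G.IsModel) {k l : Fin nE} (h : l ≠ k) :
    G.matIm l (G.src k) (G.dst k) = 0 := by
  have h₁ := hG.not_parallel h
  have h₂ := hG.not_antiparallel h
  simp [matIm, h₁, mt And.symm h₂]

lemma IsModel.neg_arg_ratio_mem (hG : G.IsModel) (k : Fin nE) :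
    -(G.ratio k).arg ∈ Set.Ioo (-(Real.pi / 2)) (Real.pi / 2) :=
  ⟨(hG.angLB_gt k).trans_le (hG.angLB_le k), (hG.le_angUB k).trans_lt (hG.angUB_lt k)⟩

/-- The angle range contains `-arg ρ` and lies within `(-π/2, π/2)`, so the cosine of `arg ρ` is
positive. -/
lemma IsModel.ratio_re_pos (hG : G.IsModel) (k : Fin nE) : 0 < (G.ratio k).re := by
  have h := hG.neg_arg_ratio_mem k
  rw [← Complex.norm_mul_cos_arg, ← Real.cos_neg]
  exact mul_pos (norm_pos_iff.2 (hG.ratio_ne k)) (Real.cos_pos_of_mem_Ioo h)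

lemma IsModel.tan_neg_arg_mul_re (hG : G.IsModel) (k : Fin nE) :
    Real.tan (-(G.ratio k).arg) * (G.ratio k).re = -(G.ratio k).im := by
  rw [Real.tan_neg, Complex.tan_arg, neg_mul, div_mul_cancel₀ _ (hG.ratio_re_pos k).ne']

/-- This is the lower angle constraint evaluated at `w = conj ρ`. It follows from the monotonicity
of the tangent on `(-π/2, π/2)`, scaled by `Re ρ > 0`. -/
lemma IsModel.tan_angLB_mul_re_le (hG : G.IsModel) (k : Fin nE) :
    Real.tan (G.angLB k) * (G.ratio k).re ≤ -(G.ratio k).im := by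
  rw [← hG.tan_neg_arg_mul_re]
  refine mul_le_mul_of_nonneg_right ?_ (hG.ratio_re_pos k).le
  exact Real.strictMonoOn_tan.monotoneOn
    ⟨hG.angLB_gt k, (hG.angLB_le k).trans_lt (hG.neg_arg_ratio_mem k).2⟩
    (hG.neg_arg_ratio_mem k) (hG.angLB_le k)

lemma IsModel.le_tan_angUB_mul_re (hG : G.IsModel) (k : Fin nE) :
    -(G.ratio k).im ≤ Real.tan (G.angUB k) * (G.ratio k).re := by
  rw [← hG.tan_neg_arg_mul_re]
  refine mul_le_mul_of_nonneg_right ?_ (hG.ratio_re_pos k).le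
  exact Real.strictMonoOn_tan.monotoneOn (hG.neg_arg_ratio_mem k)
    ⟨(hG.neg_arg_ratio_mem k).1.trans_le (hG.le_angUB k), hG.angUB_lt k⟩ (hG.le_angUB k)

lemma IsModel.re_matAng_nonneg (hG : G.IsModel) (k l : Fin nE) :
    0 ≤ (-(starRingEnd ℂ) (G.ratio k) * G.matAng l (G.src k) (G.dst k)).re := by
  rcases eq_or_ne l k with rfl | hl
  · have h := hG.ratio_re_pos l
    rw [matAng, Matrix.neg_apply, hG.matRe_src_dst]
    simp
    linarith
  · simp [matAng, hG.matRe_of_ne hl]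

lemma IsModel.re_matAngLB_nonneg (hG : G.IsModel) (k l : Fin nE) :
    0 ≤ (-(starRingEnd ℂ) (G.ratio k) * G.matAngLB l (G.src k) (G.dst k)).re := by
  rcases eq_or_ne l k with rfl | hl
  · have h := hG.tan_angLB_mul_re_le l
    rw [matAngLB, Matrix.sub_apply, Matrix.smul_apply, hG.matRe_src_dst, hG.matIm_src_dst]
    -- The tangent must stay a cast real number, so that its real and imaginary parts simplify.
    simp [-Complex.ofReal_tan]
    linarith
  · simp [matAngLB, hG.matRe_of_ne hl, hG.matIm_of_ne hl]

lemma IsModel.re_matAngUB_nonneg (hG : G.IsModel) (k l : Fin nE) :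
    0 ≤ (-(starRingEnd ℂ) (G.ratio k) * G.matAngUB l (G.src k) (G.dst k)).re := by
  rcases eq_or_ne l k with rfl | hl
  · have h := hG.le_tan_angUB_mul_re l
    rw [matAngUB, Matrix.sub_apply, Matrix.smul_apply, hG.matRe_src_dst, hG.matIm_src_dst]
    simp [-Complex.ofReal_tan]
    linarith
  · simp [matAngUB, hG.matRe_of_ne hl, hG.matIm_of_ne hl]

/-! ### Combination of the terms -/

/-- Multiplied by minus the conjugate of the total voltage ratio, the entry of a constraint matrix
that belongs to an AC branch has a nonnegative real part. -/
lemma IsModel.re_matC_nonneg (hG : G.IsModel) (k : Fin nE) (m : OPFConstraint nV nE nD) :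
    0 ≤ (-(starRingEnd ℂ) (G.ratio k) * G.matC m (G.src k) (G.dst k)).re := by
  -- The voltage and drop limits have diagonal matrices and the DC limits a zero matrix; only
  -- current and angle limits reach the entry.
  have hM := matM_apply_of_ne (hG.no_loop k)
  rcases m with ⟨a, n⟩ | ⟨a, l⟩ | ⟨a, l⟩
  · fin_cases a <;> simp [matC, hM]
  · fin_cases a
    · exact hG.re_matISrc_nonneg k l
    · exact hG.re_matIDst_nonneg k l
    · simp [matC, matDropLB, hM]
    · simp [matC, matDropUB, hM]
    · exact hG.re_matAng_nonneg k l
    · exact hG.re_matAngLB_nonneg k l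
    · exact hG.re_matAngUB_nonneg k l
  · simp [matC]

/-- The entry of `Ψ` that belongs to an AC branch does not vanish if the prices at both ends are
nonnegative and those of active power do not both vanish. -/
theorem IsModel.Psi_src_dst_ne_zero (hG : G.IsModel) {Λ : Fin nV → Fin 2 → ℝ}
    {μ : OPFConstraint nV nE nD → ℝ} (hμ : 0 ≤ μ) {k : Fin nE}
    (hi : 0 ≤ Λ (G.src k)) (hj : 0 ≤ Λ (G.dst k))
    (hpos : 0 < Λ (G.src k) 0 + Λ (G.dst k) 0) :
    G.Psi Λ μ (G.src k) (G.dst k) ≠ 0 := by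
  intro h
  have h₁ := hG.re_sum_matP_matQ_pos hi hj hpos
  have h₂ : 0 ≤ (-(starRingEnd ℂ) (G.ratio k) *
      (∑ m, μ m • G.matC m) (G.src k) (G.dst k)).re := by
    rw [Matrix.sum_apply, Finset.mul_sum, Complex.re_sum]
    refine Finset.sum_nonneg fun m _ => ?_
    rw [Matrix.smul_apply, mul_smul_comm, Complex.smul_re]
    exact mul_nonneg (hμ m) (hG.re_matC_nonneg k m)
  have h₃ := add_pos_of_pos_of_nonneg h₁ h₂
  rw [← Complex.add_re, ← mul_add, ← Matrix.add_apply] at h₃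
  change 0 < (-(starRingEnd ℂ) (G.ratio k) * G.Psi Λ μ (G.src k) (G.dst k)).re at h₃
  simp [h] at h₃

end HybridGrid

theorem mainTheorem4 {nV nE nD : ℕ} (G : HybridGrid nV nE nD) (hG : G.IsModel)
    (K : PowerMarket nV) (hK : K.IsModel)
    (Λ : Fin nV → Fin 2 → ℝ) (μ : OPFConstraint nV nE nD → ℝ)
    (L : Fin nE → Matrix (Fin 2) (Fin 2) ℂ) (hopt : G.IsDualOptimizer K Λ μ L)
    (k : Fin nE) (hi : 0 ≤ Λ (G.src k)) (hj : 0 ≤ Λ (G.dst k))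
    (hpos : 0 < Λ (G.src k) 0 + Λ (G.dst k) 0) :
    (Λ, μ) ∉ G.setA k ∧ G.Psi Λ μ (G.src k) (G.dst k) ≠ 0 := by
  have h := hG.Psi_src_dst_ne_zero hopt.1.mu_nonneg hi hj hpos
  -- Both conjuncts unfold to the same statement.
  exact ⟨h, h⟩
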